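/- Let $a<b$, $N\ge 1$, and let $L\colon C([a,b])\to\mathbb{R}$ be a positive linear functional (i.e. $L[f]\ge 0$ whenever $f\ge 0$). For $\ell>0$ let $\mathcal{H}(K_\ell)$ be the reproducing kernel Hilbert space on $[a,b]$ of the Gaussian kernel $K_\ell(x,x')=\exp\!\big(-(x-x')^2/(2\ell^2)\big)$. For points $X=(x_1,\dots,x_N)\in[a,b]^N$ and weights $w=(w(1),\dots,w(N))\in\mathbb{R}^N$ write $Q_X(w)[f]=\sum_{n=1}^N w(n)f(x_n)$, and define the worst-case error $$e_\ell\big(Q_X(w)\big)=\sup_{\|f\|_{\mathcal{H}(K_\ell)}\le 1}\big|L[f]-Q_X(w)[f]\big|.$$ An optimal kernel quadrature rule for $\ell$ is given by a pair $(X,w)$ with $x_1<\dots<x_N$ such that $e_\ell(Q_X(w))=\inf_{Y\in[a,b]^N,\,v\in\mathbb{R}^N}e_\ell(Q_Y(v))$. Suppose that for every $\ell>0$ there is exactly one such pair, denoted $(X_\ell^*,w_\ell^*)$. Then there are unique points $X_{\mathrm G}=(x_1<\dots<x_N)$ in $[a,b]$ and weights $w_{\mathrm G}\in\mathbb{R}^N$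 such that $Q_{X_{\mathrm G}}(w_{\mathrm G})[x^n]=L[x^n]$ for every $0\le n\le 2N-1$ (the $N$-point Gaussian quadrature rule for $L$), and $$\lim_{\ell\to\infty}X_\ell^*=X_{\mathrm G},\qquad \lim_{\ell\to\infty}w_\ell^*=w_{\mathrm G}.$$ Moreover, $e_\ell\big(Q_{X_\ell^*}(w_\ell^*)\big)=\mathcal{O}(\ell^{-2N})$ as $\ell\to\infty$. -/

import Mathlib

open Filter Topology Asymptotics

noncomputable section

namespace FlatLimit

/-- The Gaussian kernel `K_ℓ(x, y) = exp(-(x - y)² / (2ℓ²))` on `[a, b]`. A scalar `c` is written as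
the operator `c • id` on `ℝ`, which is the form of Mathlib's (operator-valued) kernels. -/
def gaussianKernel (a b ℓ : ℝ) : Matrix (Set.Icc a b) (Set.Icc a b) (ℝ →L[ℝ] ℝ) :=
  .of fun x y => Real.exp (-((x : ℝ) - y) ^ 2 / (2 * ℓ ^ 2)) • ContinuousLinearMap.id ℝ ℝ

lemma gaussianKernel_apply (a b ℓ : ℝ) (x y : Set.Icc a b) (v : ℝ) :
    gaussianKernel a b ℓ x y v = Real.exp (-((x : ℝ) - y) ^ 2 / (2 * ℓ ^ 2)) * v := by
  simp [gaussianKernel]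

lemma gaussian_sum_nonneg {ι : Type*} (s : Finset ι) (x v : ι → ℝ) (ℓ : ℝ) :
    0 ≤ ∑ i ∈ s, ∑ j ∈ s, v i * v j * Real.exp (-(x j - x i) ^ 2 / (2 * ℓ ^ 2)) := by
  set c : ℝ := (2 * ℓ ^ 2)⁻¹ with hc
  have hc0 : 0 ≤ c := by positivity
  have hsum : HasSum (fun n : ℕ => ((n.factorial : ℝ)⁻¹ * (2 * c) ^ n) *
      (∑ i ∈ s, v i * Real.exp (-c * x i ^ 2) * x i ^ n) ^ 2)
      (∑ i ∈ s, ∑ j ∈ s, v i * v j * Real.exp (-(x j - x i) ^ 2 / (2 * ℓ ^ 2))) := by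
    have h1 : ∀ i j, HasSum (fun n : ℕ => ((n.factorial : ℝ)⁻¹ * (2 * c) ^ n) *
        ((v i * Real.exp (-c * x i ^ 2) * x i ^ n) * (v j * Real.exp (-c * x j ^ 2) * x j ^ n)))
        (v i * v j * Real.exp (-(x j - x i) ^ 2 / (2 * ℓ ^ 2))) := by
      intro i j
      have h := (NormedSpace.expSeries_div_hasSum_exp (2 * c * x i * x j)).mul_left
        (v i * v j * Real.exp (-c * x i ^ 2) * Real.exp (-c * x j ^ 2))
      have e : v i * v j * Real.exp (-c * x i ^ 2) * Real.exp (-c * x j ^ 2) *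
          NormedSpace.exp (2 * c * x i * x j)
          = v i * v j * Real.exp (-(x j - x i) ^ 2 / (2 * ℓ ^ 2)) := by
        rw [← Real.exp_eq_exp_ℝ, mul_assoc, mul_assoc, ← Real.exp_add, ← Real.exp_add,
          div_eq_mul_inv, ← hc]
        ring_nf
      rw [e] at h
      refine h.congr_fun ?_
      intro n
      simp only [mul_pow, div_eq_mul_inv]
      ring
    have h2 := hasSum_sum (s := s) fun i _ => hasSum_sum (s := s) fun j _ => h1 i j
    refine h2.congr_fun ?_
    intro n
    rw [pow_two (Finset.sum _ _), Finset.sum_mul_sum]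
    simp only [Finset.mul_sum]
  exact hsum.nonneg fun n => by positivity

lemma posSemidef_gaussianKernel (a b ℓ : ℝ) : (gaussianKernel a b ℓ).PosSemidef := by
  have tfae := (RKHS.posSemidef_tfae (K := gaussianKernel a b ℓ)).out 0 2
  refine tfae.mpr ⟨?_, fun vv => ?_⟩
  · ext x y
    simp [gaussianKernel, Matrix.conjTranspose_apply, sub_sq_comm]
    exact congrArg (fun T : ℝ →L[ℝ] ℝ => T 1) (star_one (ℝ →L[ℝ] ℝ))
  · have h := gaussian_sum_nonneg vv.support (fun x => (x : ℝ)) vv ℓ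
    simp only [Finsupp.sum, RCLike.re_to_real, gaussianKernel_apply]
    refine h.trans_eq ?_
    refine Finset.sum_congr rfl fun i _ => Finset.sum_congr rfl fun j _ => ?_
    simp
    ring

instance (a b ℓ : ℝ) : Fact (gaussianKernel a b ℓ).PosSemidef := ⟨posSemidef_gaussianKernel a b ℓ⟩

/-- The reproducing kernel Hilbert space `H(K_ℓ)` of the Gaussian kernel on `[a, b]`. -/
abbrev GaussianRKHS (a b ℓ : ℝ) : Type := RKHS.OfKernel (gaussianKernel a b ℓ)

lemma continuous_gaussianRKHS {a b ℓ : ℝ} (f : GaussianRKHS a b ℓ) :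
    Continuous (fun x : Set.Icc a b => f x) := by
  have key : ∀ x y : Set.Icc a b, inner ℝ (RKHS.kerFun (GaussianRKHS a b ℓ) y (1 : ℝ))
      (RKHS.kerFun (GaussianRKHS a b ℓ) x (1 : ℝ))
      = Real.exp (-((x : ℝ) - y) ^ 2 / (2 * ℓ ^ 2)) := by
    intro x y
    rw [← RKHS.kernel_inner, RKHS.OfKernel.kernel_ofKernel, gaussianKernel_apply]
    simp
  have hf : ∀ x, f x = inner ℝ f (RKHS.kerFun (GaussianRKHS a b ℓ) x (1 : ℝ)) := by
    intro x; simp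
  simp only [hf]
  refine Continuous.inner continuous_const ?_
  rw [continuous_iff_continuousAt]
  intro y
  rw [ContinuousAt, tendsto_iff_norm_sub_tendsto_zero]
  have hn : ∀ x, ‖RKHS.kerFun (GaussianRKHS a b ℓ) x (1 : ℝ)
      - RKHS.kerFun (GaussianRKHS a b ℓ) y (1 : ℝ)‖
      = √(2 - 2 * Real.exp (-((y : ℝ) - x) ^ 2 / (2 * ℓ ^ 2))) := by
    intro x
    rw [@norm_eq_sqrt_real_inner, inner_sub_left, inner_sub_right, inner_sub_right, key, key, key,
      key, show ((x : ℝ) - y) ^ 2 = ((y : ℝ) - x) ^ 2 by ring]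
    congr 1
    simp
    ring
  simp only [hn]
  have hc : Continuous fun x : Set.Icc a b =>
      √(2 - 2 * Real.exp (-((y : ℝ) - x) ^ 2 / (2 * ℓ ^ 2))) := by fun_prop
  simpa using hc.tendsto y

/-- An element of `H(K_ℓ)` as a continuous function on `[a, b]`. -/
def GaussianRKHS.toContinuousMap {a b ℓ : ℝ} (f : GaussianRKHS a b ℓ) : C(Set.Icc a b, ℝ) :=
  ⟨fun x => f x, continuous_gaussianRKHS f⟩

/-- The quadrature rule `Q_X(w)[f] = ∑ₙ w(n) f(xₙ)`. -/
def quadrature {a b : ℝ} {N : ℕ} (X : Fin N → Set.Icc a b) (w : Fin N → ℝ)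
    (f : C(Set.Icc a b, ℝ)) : ℝ :=
  ∑ n, w n * f (X n)

/-- The worst-case error `e_ℓ(Q_X(w)) = sup_{‖f‖ ≤ 1} |L[f] - Q_X(w)[f]|` over the unit ball of
`H(K_ℓ)`. The supremum is finite: `|f| ≤ ‖f‖` pointwise and `L` is positive on `C([a, b])`. -/
def worstCaseError {a b : ℝ} {N : ℕ} (L : C(Set.Icc a b, ℝ) →ₚ[ℝ] ℝ) (ℓ : ℝ)
    (X : Fin N → Set.Icc a b) (w : Fin N → ℝ) : ℝ :=
  ⨆ f : {f : GaussianRKHS a b ℓ // ‖f‖ ≤ 1},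
    |L f.1.toContinuousMap - quadrature X w f.1.toContinuousMap|

/-- `Q_X(w)`, with distinct points in ascending order, minimises the worst-case error among all
choices of `N` points in `[a, b]` and `N` real weights. -/
def IsOptimalRule {a b : ℝ} {N : ℕ} (L : C(Set.Icc a b, ℝ) →ₚ[ℝ] ℝ) (ℓ : ℝ)
    (X : Fin N → Set.Icc a b) (w : Fin N → ℝ) : Prop :=
  StrictMono X ∧ ∀ (Y : Fin N → Set.Icc a b) (v : Fin N → ℝ),
    worstCaseError L ℓ X w ≤ worstCaseError L ℓ Y v

/-- The monomial `x ↦ xⁿ` on `[a, b]`. -/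
def monomial (a b : ℝ) (n : ℕ) : C(Set.Icc a b, ℝ) := ⟨fun x => (x : ℝ) ^ n, by fun_prop⟩

/-- `Q_X(w)`, with distinct points in ascending order, is an `N`-point Gaussian quadrature rule
for `L`: it is exact for `xⁿ`, `0 ≤ n ≤ 2N - 1`. -/
def IsGaussianRule {a b : ℝ} {N : ℕ} (L : C(Set.Icc a b, ℝ) →ₚ[ℝ] ℝ)
    (X : Fin N → Set.Icc a b) (w : Fin N → ℝ) : Prop :=
  StrictMono X ∧ ∀ n < 2 * N, quadrature X w (monomial a b n) = L (monomial a b n)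

end FlatLimit

end

/-! Put D = L - Q_X(w). By Riesz representation e_ℓ² is D applied to both arguments of K_ℓ, and
K_ℓ(x, y) = ∑ φₙ(x) φₙ(y) with φₙ(x) = exp(-x²/(2ℓ²)) xⁿ / (ℓⁿ √n!) turns this into ∑ (D φₙ)².

For the Gaussian rule, D kills degrees below 2N. Expanding K_ℓ in ℓ⁻² leaves only a remainder of
order ℓ^(-4N), so e_ℓ = O(ℓ^(-2N)) (`exists_worstCaseError_le`), and optimal rules inherit the
bound. Conversely |D φₙ| ≤ e_ℓ, so that rate forces D[exp(-x²/(2ℓ²)) xⁿ] = O(ℓ^(n-2N)) → 0 for n <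
2N (`tendsto_weighted_moments`). Convergence of 2N moments already forces convergence to the
Gaussian rule (`tendsto_of_tendsto_moments`): limit nodes are the zeros of the orthogonal polynomial
of degree N.

All this needs L[p²] > 0 for nonzero p of degree < N. Otherwise L lives on fewer than N points, a
node can be placed at will, and optimal rules are not unique (`polyFunctional_sq_pos`). -/

noncomputable section

namespace FlatLimit

/-! ### Orthogonal polynomials and existence of the Gaussian rule -/

section Moments

open Polynomial Finset

variable {N : ℕ} {Λ : ℝ[X] →ₗ[ℝ] ℝ}

/-- The form Λ(pq) is definite in degree < N, so some r of degree < N represents q ↦ Λ(X^N q); take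
X^N - r. -/
lemma exists_monic_orthogonal (hpos : ∀ p : ℝ[X], p ≠ 0 → p.degree < N → 0 < Λ (p ^ 2)) :
    ∃ p : ℝ[X], p.Monic ∧ p.degree = N ∧ ∀ q : ℝ[X], q.degree < N → Λ (p * q) = 0 := by
  let B : degreeLT ℝ N →ₗ[ℝ] Module.Dual ℝ (degreeLT ℝ N) :=
    LinearMap.mk₂ ℝ (fun p q => Λ ((p : ℝ[X]) * q))
      (fun _ _ _ => by simp [add_mul]) (fun _ _ _ => by simp)
      (fun _ _ _ => by simp [mul_add]) (fun _ _ _ => by simp)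
  have hB : Function.Injective B := by
    rw [injective_iff_map_eq_zero]
    intro p hp
    by_contra hne
    have h := hpos p (by simpa using hne) (mem_degreeLT.mp p.2)
    have h0 : Λ ((p : ℝ[X]) * p) = 0 := by
      have := LinearMap.congr_fun hp p
      simpa [B] using this
    rw [pow_two, h0] at h
    exact lt_irrefl _ h
  have hfd : FiniteDimensional ℝ (degreeLT ℝ N) :=
    (degreeLTEquiv ℝ N).symm.finiteDimensional
  have hsurj : Function.Surjective B :=
    (LinearMap.injective_iff_surjective_of_finrank_eq_finrank
      (Subspace.dual_finrank_eq (K := ℝ) (V := degreeLT ℝ N)).symm).mp hB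
  obtain ⟨r, hr⟩ := hsurj
    ((Λ ∘ₗ LinearMap.mulLeft ℝ (X ^ N : ℝ[X])) ∘ₗ (degreeLT ℝ N).subtype)
  have hrd : (r : ℝ[X]).degree < N := mem_degreeLT.mp r.2
  have hrX : (r : ℝ[X]).degree < (X ^ N : ℝ[X]).degree := by rwa [degree_X_pow]
  refine ⟨X ^ N - (r : ℝ[X]), (monic_X_pow N).sub_of_left hrX, ?_, fun q hq => ?_⟩
  · rw [degree_sub_eq_left_of_degree_lt hrX, degree_X_pow]
  · have := LinearMap.congr_fun hr ⟨q, mem_degreeLT.mpr hq⟩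
    simp [B] at this
    rw [sub_mul, map_sub, this, sub_self]

lemma monic_orthogonal_unique (hpos : ∀ p : ℝ[X], p ≠ 0 → p.degree < N → 0 < Λ (p ^ 2))
    {p q : ℝ[X]} (hp : p.Monic) (hpN : p.degree = N) (hq : q.Monic) (hqN : q.degree = N)
    (hpo : ∀ r : ℝ[X], r.degree < N → Λ (p * r) = 0)
    (hqo : ∀ r : ℝ[X], r.degree < N → Λ (q * r) = 0) : p = q := by
  by_contra hne
  have hd : (p - q).degree < N := hpN ▸
    degree_sub_lt_left (by rw [hpN, hqN]) hp.ne_zero (by rw [hp, hq])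
  have h := hpos (p - q) (sub_ne_zero.mpr hne) hd
  rw [pow_two, sub_mul, map_sub, hpo _ hd, hqo _ hd, sub_zero] at h
  exact lt_irrefl _ h

lemma natDegree_add_of_eq_mul {n k : ℕ} {p r s : ℝ[X]} (hs : s ≠ 0) (hp : p.degree = n)
    (h : p = r * s) (hr : r.natDegree = k) : s.natDegree + k = n := by
  have hp0 : p ≠ 0 := by rintro rfl; simp at hp
  have hr0 : r ≠ 0 := by rintro rfl; simp [hp0] at h
  have := natDegree_eq_of_degree_eq_some hp
  rw [h, natDegree_mul hr0 hs] at this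
  omega

/-- If p = (X - x)² s, then Λ(p s) = Λ(((X - x) s)²) > 0, against orthogonality. -/
lemma orthogonal_root_simple (hpos : ∀ p : ℝ[X], p ≠ 0 → p.degree < N → 0 < Λ (p ^ 2))
    {p : ℝ[X]} (hpN : p.degree = N)
    (hpo : ∀ q : ℝ[X], q.degree < N → Λ (p * q) = 0) : p.roots.Nodup := by
  have hp0 : p ≠ 0 := by rintro rfl; simp at hpN
  rw [Multiset.nodup_iff_count_le_one]
  intro x
  by_contra hx
  rw [count_roots, not_le, ← Nat.succ_le_iff, le_rootMultiplicity_iff hp0] at hx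
  obtain ⟨s, hs⟩ := hx
  have hs0 : s ≠ 0 := by rintro rfl; simp [hp0] at hs
  have hd := natDegree_add_of_eq_mul hs0 hpN hs (k := 2) (by simp)
  have h0 := hpo s ((natDegree_lt_iff_degree_lt hs0).mp (by omega))
  have hne : (X - C x) * s ≠ 0 := mul_ne_zero (X_sub_C_ne_zero x) hs0
  have h1 := hpos ((X - C x) * s) hne ((natDegree_lt_iff_degree_lt hne).mp (by
    rw [natDegree_mul (X_sub_C_ne_zero x) hs0, natDegree_X_sub_C]; omega))
  rw [hs] at h0
  rw [show ((X - C x) * s) ^ 2 = (X - C x) ^ (Nat.succ 1) * s * s by ring, h0] at h1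
  exact lt_irrefl _ h1

lemma exists_eq_sq_add_of_irreducible {q : ℝ[X]} (hq : Irreducible q) (h2 : q.natDegree = 2) :
    ∃ c α γ : ℝ, c ≠ 0 ∧ 0 < γ ∧ q = C c * ((X - C α) ^ 2 + C γ) := by
  have hc : q.coeff 2 ≠ 0 := by
    rw [← h2]; exact leadingCoeff_ne_zero.mpr hq.ne_zero
  set c := q.coeff 2
  set α := -(q.coeff 1) / (2 * c)
  set γ := q.coeff 0 / c - α ^ 2
  have e : q = C c * ((X - C α) ^ 2 + C γ) := by
    have h := as_sum_range_C_mul_X_pow q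
    rw [h2] at h
    simp only [sum_range_succ, range_zero, sum_empty, zero_add, pow_zero, mul_one,
      pow_one] at h
    have h1 : q.coeff 1 = -(2 * c * α) := by simp only [α]; field_simp
    have h0 : q.coeff 0 = c * (γ + α ^ 2) := by simp only [γ]; field_simp; ring
    conv_lhs => rw [h, h1, h0]
    change _ + C c * X ^ 2 = _
    simp only [map_neg, map_mul, map_add, map_pow, map_ofNat]
    ring
  refine ⟨c, α, γ, hc, ?_, e⟩
  by_contra hγ
  have hroot : q.IsRoot (α + √(-γ)) := by
    rw [e, IsRoot.def]
    simp [Real.sq_sqrt (by linarith : 0 ≤ -γ)]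
  have := degree_eq_one_of_irreducible_of_root hq hroot
  rw [degree_eq_natDegree hq.ne_zero, h2] at this
  norm_num at this

/-- An irreducible quadratic factor c((X - α)² + γ) with cofactor s would give Λ(p s) = c(Λ(((X -
α)s)²) + γ Λ(s²)) ≠ 0. -/
lemma orthogonal_splits (hpos : ∀ p : ℝ[X], p ≠ 0 → p.degree < N → 0 < Λ (p ^ 2))
    {p : ℝ[X]} (hpN : p.degree = N)
    (hpo : ∀ q : ℝ[X], q.degree < N → Λ (p * q) = 0) : p.Splits := by
  have hp0 : p ≠ 0 := by rintro rfl; simp at hpN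
  obtain ⟨u, hu⟩ := UniqueFactorizationMonoid.factors_prod hp0
  rw [← hu]
  refine (Splits.multisetProd fun q hqm => Splits.of_degree_eq_one ?_).mul u.isUnit.splits
  have hq := UniqueFactorizationMonoid.irreducible_of_factor q hqm
  have hdvd := UniqueFactorizationMonoid.dvd_of_mem_factors hqm
  have h1 := hq.natDegree_pos
  have h2 := hq.natDegree_le_two
  rcases (by omega : q.natDegree = 1 ∨ q.natDegree = 2) with h | h
  · rw [degree_eq_natDegree hq.ne_zero, h]; rfl
  exfalso
  obtain ⟨c, α, γ, hc, hγ, e⟩ := exists_eq_sq_add_of_irreducible hq h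
  obtain ⟨s, hs⟩ := hdvd
  have hs0 : s ≠ 0 := by rintro rfl; simp [hp0] at hs
  have hd := natDegree_add_of_eq_mul hs0 hpN hs h
  have hsd : s.degree < N := (natDegree_lt_iff_degree_lt hs0).mp (by omega)
  have h0 := hpo s hsd
  have hne : (X - C α) * s ≠ 0 := mul_ne_zero (X_sub_C_ne_zero α) hs0
  have h3 := hpos ((X - C α) * s) hne ((natDegree_lt_iff_degree_lt hne).mp (by
    rw [natDegree_mul (X_sub_C_ne_zero α) hs0, natDegree_X_sub_C]; omega))
  have h4 := hpos s hs0 hsd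
  rw [hs, e, show C c * ((X - C α) ^ 2 + C γ) * s * s =
    c • (((X - C α) * s) ^ 2 + γ • s ^ 2) by simp only [smul_eq_C_mul]; ring] at h0
  rw [map_smul, map_add, map_smul, smul_eq_mul, smul_eq_mul] at h0
  have : 0 < Λ (((X - C α) * s) ^ 2) + γ * Λ (s ^ 2) := by positivity
  exact (mul_ne_zero hc this.ne') h0

/-- With p = (X - x) s, orthogonality gives Λ((X - a) s²) = (x - a) Λ(s²), and likewise at b. -/
lemma orthogonal_root_mem (hpos : ∀ p : ℝ[X], p ≠ 0 → p.degree < N → 0 < Λ (p ^ 2))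
    {a b : ℝ} (ha : ∀ p : ℝ[X], 0 ≤ Λ ((X - C a) * p ^ 2))
    (hb : ∀ p : ℝ[X], 0 ≤ Λ ((C b - X) * p ^ 2))
    {p : ℝ[X]} (hpN : p.degree = N)
    (hpo : ∀ q : ℝ[X], q.degree < N → Λ (p * q) = 0) {x : ℝ} (hx : p.IsRoot x) :
    x ∈ Set.Icc a b := by
  have hp0 : p ≠ 0 := by rintro rfl; simp at hpN
  obtain ⟨s, hs⟩ := dvd_iff_isRoot.mpr hx
  have hs0 : s ≠ 0 := by rintro rfl; simp [hp0] at hs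
  have hd := natDegree_add_of_eq_mul hs0 hpN hs (natDegree_X_sub_C x)
  have hsd : s.degree < N := (natDegree_lt_iff_degree_lt hs0).mp (by omega)
  have h0 := hpo s hsd
  have h1 := hpos s hs0 hsd
  have h2 := ha s
  have h3 := hb s
  rw [hs] at h0
  rw [show (X - C a) * s ^ 2 = (X - C x) * s * s + (x - a) • s ^ 2 by
    simp only [smul_eq_C_mul, map_sub]; ring, map_add, h0, map_smul, smul_eq_mul, zero_add] at h2
  rw [show (C b - X) * s ^ 2 = -((X - C x) * s * s) + (b - x) • s ^ 2 by
    simp only [smul_eq_C_mul, map_sub]; ring, map_add, map_neg, h0, map_smul, smul_eq_mul, neg_zero,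
    zero_add] at h3
  constructor
  · have := nonneg_of_mul_nonneg_left h2 h1; linarith
  · have := nonneg_of_mul_nonneg_left h3 h1; linarith

/-- An `N`-point rule exact on polynomials of degree `< 2N`, for a moment functional. -/
lemma exists_gauss (hpos : ∀ p : ℝ[X], p ≠ 0 → p.degree < N → 0 < Λ (p ^ 2))
    {a b : ℝ} (ha : ∀ p : ℝ[X], 0 ≤ Λ ((X - C a) * p ^ 2))
    (hb : ∀ p : ℝ[X], 0 ≤ Λ ((C b - X) * p ^ 2)) :
    ∃ (x w : Fin N → ℝ), StrictMono x ∧ (∀ i, x i ∈ Set.Icc a b) ∧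
      ∀ p : ℝ[X], p.degree < (2 * N : ℕ) → ∑ i, w i * p.eval (x i) = Λ p := by
  obtain ⟨p, hpm, hpN, hpo⟩ := exists_monic_orthogonal hpos
  have hcard : p.roots.toFinset.card = N := by
    rw [Multiset.toFinset_card_of_nodup (orthogonal_root_simple hpos hpN hpo),
      ← (orthogonal_splits hpos hpN hpo).natDegree_eq_card_roots,
      natDegree_eq_of_degree_eq_some hpN]
  let x := p.roots.toFinset.orderEmbOfFin hcard
  have hroot : ∀ i, p.IsRoot (x i) := fun i =>
    isRoot_of_mem_roots (Multiset.mem_toFinset.mp (p.roots.toFinset.orderEmbOfFin_mem hcard i))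
  refine ⟨x, fun i => Λ (Lagrange.basis univ x i), x.strictMono,
    fun i => orthogonal_root_mem hpos ha hb hpN hpo (hroot i), fun q hq => ?_⟩
  -- Divide q by p: the quotient part is killed by orthogonality and vanishes at the nodes, and the
  -- remainder equals its interpolant there.
  have hr : (q %ₘ p).degree < N := hpN ▸ degree_modByMonic_lt q hpm
  have hdiv : (q /ₘ p).degree < N := by
    by_cases h0 : q /ₘ p = 0
    · simp [h0]
    have hq0 : q ≠ 0 := by rintro rfl; simp at h0
    have h1 := natDegree_divByMonic q hpm
    rw [natDegree_eq_of_degree_eq_some hpN] at h1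
    have h2 := (natDegree_lt_iff_degree_lt hq0).mpr hq
    have h3 : 0 < N := by
      rcases Nat.eq_zero_or_pos N with rfl | h
      · simp at h2
      · exact h
    exact (natDegree_lt_iff_degree_lt h0).mp (by omega)
  have hinterp : q %ₘ p = Lagrange.interpolate univ x fun i => q.eval (x i) := by
    refine Lagrange.eq_interpolate_of_eval_eq _ x.injective.injOn (by simpa using hr) fun i _ => ?_
    conv_rhs => rw [← modByMonic_add_div q p]
    simp [(hroot i).eq_zero]
  conv_rhs => rw [← modByMonic_add_div q p, map_add, hpo _ hdiv, add_zero, hinterp]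
  rw [Lagrange.interpolate_apply, map_sum]
  refine sum_congr rfl fun i _ => ?_
  rw [← smul_eq_C_mul, map_smul, smul_eq_mul, mul_comm]

end Moments

/-! ### Convergence of moments implies convergence of rules -/

section MomentLimits

open Polynomial Finset

variable {N : ℕ} {Λ : ℝ[X] →ₗ[ℝ] ℝ}

lemma continuous_coeff_nodal {ι : Type*} [DecidableEq ι] (s : Finset ι) (n : ℕ) :
    Continuous fun y : ι → ℝ => (Lagrange.nodal s y).coeff n := by
  induction s using Finset.induction_on generalizing n with
  | empty => simpa using continuous_const
  | insert i s hi ih =>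
    simp only [Lagrange.nodal_insert_eq_nodal hi, sub_mul, coeff_sub, coeff_C_mul]
    refine Continuous.sub ?_ ((continuous_apply i).mul (ih n))
    cases n with
    | zero => simpa using continuous_const
    | succ n => simpa only [coeff_X_mul] using ih n

/-- The uniform degree bound makes this a finite sum of coefficient times moment, so no bound on
individual weights is needed. -/
lemma tendsto_sum_eval {ι : Type*} {l : Filter ι} {m : ℕ} {x v : ι → Fin N → ℝ}
    (hlim : ∀ n < m, Tendsto (fun t => ∑ i, v t i * x t i ^ n) l (𝓝 (Λ (X ^ n))))
    {q : ι → ℝ[X]} {Q : ℝ[X]} (hq : ∀ t, (q t).degree < m) (hQ : Q.degree < m)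
    (hc : ∀ n, Tendsto (fun t => (q t).coeff n) l (𝓝 (Q.coeff n))) :
    Tendsto (fun t => ∑ i, v t i * (q t).eval (x t i)) l (𝓝 (Λ Q)) := by
  have e : ∀ p : ℝ[X], p.degree < m → p = ∑ n ∈ range m, p.coeff n • X ^ n := by
    intro p hp
    by_cases h0 : p = 0
    · simp [h0]
    conv_lhs => rw [as_sum_range' p m ((natDegree_lt_iff_degree_lt h0).mpr hp)]
    simp only [smul_X_eq_monomial]
  have e1 : ∀ t, ∑ i, v t i * (q t).eval (x t i)
      = ∑ n ∈ range m, (q t).coeff n * ∑ i, v t i * x t i ^ n := by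
    intro t
    conv_lhs => rw [e _ (hq t)]
    simp only [eval_finsetSum, eval_smul, eval_pow, eval_X, smul_eq_mul, mul_sum]
    rw [sum_comm]
    exact sum_congr rfl fun _ _ => sum_congr rfl fun _ _ => by ring
  have e2 : Λ Q = ∑ n ∈ range m, Q.coeff n * Λ (X ^ n) := by
    conv_lhs => rw [e _ hQ]
    simp [map_sum]
  simp only [e1, e2]
  exact tendsto_finsetSum _ fun n hn => (hc n).mul (hlim n (mem_range.mp hn))

/-- Limits of increasing nodes may a priori coalesce, so y is only monotone; counting the N distinct
roots restores injectivity. -/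
lemma eq_of_nodal_eq {x y : Fin N → ℝ} (hx : StrictMono x) (hy : Monotone y)
    (h : Lagrange.nodal univ y = Lagrange.nodal univ x) : y = x := by
  have hmem : ∀ (z : Fin N → ℝ) (c : ℝ),
      c ∈ Set.range z ↔ (Lagrange.nodal univ z).eval c = 0 := by
    intro z c
    rw [Lagrange.eval_nodal, prod_eq_zero_iff]
    simp [sub_eq_zero, eq_comm]
  have hr : Set.range y = Set.range x := by
    ext c; rw [hmem, hmem, h]
  have him : univ.image y = univ.image x := by
    apply Finset.coe_injective; simpa using hr
  have hinj : Function.Injective y := by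
    have : (univ.image y).card = (univ : Finset (Fin N)).card := by
      rw [him, card_image_of_injective _ hx.injective]
    simpa using card_image_iff.mp this
  exact ((hy.strictMono_of_injective hinj).range_inj hx).mp hr

/-- Rules whose first `2N` moments converge to those of `Λ` converge to the Gaussian rule. -/
lemma tendsto_of_tendsto_moments (hpos : ∀ p : ℝ[X], p ≠ 0 → p.degree < N → 0 < Λ (p ^ 2))
    {xG wG : Fin N → ℝ} (hxG : StrictMono xG)
    (hG : ∀ p : ℝ[X], p.degree < (2 * N : ℕ) → ∑ i, wG i * p.eval (xG i) = Λ p)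
    {a b : ℝ} {ι : Type*} {l : Filter ι} {x v : ι → Fin N → ℝ} (hx : ∀ᶠ t in l, Monotone (x t))
    (hab : ∀ t i, x t i ∈ Set.Icc a b)
    (hlim : ∀ n < 2 * N, Tendsto (fun t => ∑ i, v t i * x t i ^ n) l (𝓝 (Λ (X ^ n)))) :
    Tendsto x l (𝓝 xG) ∧ Tendsto v l (𝓝 wG) := by
  have hdeg : ∀ (y : Fin N → ℝ) (r : ℝ[X]), r.degree < N →
      (Lagrange.nodal univ y * r).degree < (2 * N : ℕ) := by
    intro y r hr
    rw [degree_mul, Lagrange.degree_nodal, card_univ, Fintype.card_fin, two_mul, Nat.cast_add]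
    exact WithBot.add_lt_add_left (WithBot.coe_ne_bot) hr
  -- By compactness it suffices to identify the limit y of the nodes along each finer ultrafilter.
  have hxlim : Tendsto x l (𝓝 xG) := by
    rw [tendsto_iff_ultrafilter]
    intro g hg
    obtain ⟨y, -, hy⟩ := (isCompact_univ_pi fun _ : Fin N => isCompact_Icc (a := a) (b := b)
      ).ultrafilter_le_nhds' (g.map x) (Filter.mem_map.mpr (Filter.univ_mem' fun t i _ => hab t i))
    have hy' : Tendsto x g (𝓝 y) := hy
    have hmono : Monotone y := fun i j hij =>
      le_of_tendsto_of_tendsto (tendsto_pi_nhds.mp hy' i) (tendsto_pi_nhds.mp hy' j)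
        ((hx.filter_mono hg).mono fun t ht => ht hij)
    -- The nodal polynomial of `x t` vanishes at its own nodes, so the sums converging to this value
    -- are all zero.
    have horth : ∀ r : ℝ[X], r.degree < N → Λ (Lagrange.nodal univ y * r) = 0 := by
      intro r hr
      have h := tendsto_sum_eval (fun n hn => (hlim n hn).mono_left hg)
        (q := fun t => Lagrange.nodal univ (x t) * r) (fun t => hdeg _ r hr) (hdeg y r hr)
        (fun n => by
          simp only [coeff_mul]
          exact tendsto_finsetSum _ fun k _ =>
            (((continuous_coeff_nodal univ k.1).tendsto y).comp hy').mul_const _)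
      refine tendsto_nhds_unique h ?_
      simp [Lagrange.eval_nodal_at_node]
    have horthG : ∀ r : ℝ[X], r.degree < N → Λ (Lagrange.nodal univ xG * r) = 0 := by
      intro r hr
      rw [← hG _ (hdeg _ r hr)]
      simp [Lagrange.eval_nodal_at_node]
    have := monic_orthogonal_unique hpos Lagrange.nodal_monic (by simp [Lagrange.degree_nodal])
      Lagrange.nodal_monic (by simp [Lagrange.degree_nodal]) horth horthG
    rw [← eq_of_nodal_eq hxG hmono this]
    exact hy'
  refine ⟨hxlim, tendsto_pi_nhds.mpr fun i => ?_⟩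
  -- Omitting node i from the nodal polynomial isolates the i-th weight, times a product with
  -- nonzero limit.
  have hdeg' : ∀ y : Fin N → ℝ, (Lagrange.nodal (univ.erase i) y).degree < (2 * N : ℕ) := by
    intro y
    rw [Lagrange.degree_nodal, card_erase_of_mem (mem_univ i), card_univ, Fintype.card_fin]
    have := i.pos
    exact_mod_cast (by omega : N - 1 < 2 * N)
  have heval : ∀ u y : Fin N → ℝ, ∑ j, u j * (Lagrange.nodal (univ.erase i) y).eval (y j)
      = u i * ∏ j ∈ univ.erase i, (y i - y j) := by
    intro u y
    rw [sum_eq_single i, Lagrange.eval_nodal]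
    · intro j _ hj
      rw [Lagrange.eval_nodal_at_node (by simpa using hj), mul_zero]
    · simp
  have h := tendsto_sum_eval hlim (q := fun t => Lagrange.nodal (univ.erase i) (x t))
    (fun t => hdeg' _) (hdeg' xG)
    (fun n => ((continuous_coeff_nodal _ n).tendsto xG).comp hxlim)
  rw [← hG _ (hdeg' xG), heval] at h
  simp only [heval] at h
  have hd : Tendsto (fun t => ∏ j ∈ univ.erase i, (x t i - x t j)) l
      (𝓝 (∏ j ∈ univ.erase i, (xG i - xG j))) :=
    tendsto_finsetProd _ fun j _ =>
      (tendsto_pi_nhds.mp hxlim i).sub (tendsto_pi_nhds.mp hxlim j)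
  have hne : ∏ j ∈ univ.erase i, (xG i - xG j) ≠ 0 :=
    prod_ne_zero_iff.mpr fun j hj =>
      sub_ne_zero.mpr fun h => (ne_of_mem_erase hj) (hxG.injective h).symm
  have hdiv := h.div hd hne
  rw [mul_div_cancel_right₀ _ hne] at hdiv
  refine hdiv.congr' ?_
  filter_upwards [hd.eventually_ne hne] with t ht
  exact mul_div_cancel_right₀ _ ht

end MomentLimits

/-! ### Worst-case error and the feature expansion of the kernel -/

section ErrorFunctional

variable {a b : ℝ} {N : ℕ}

lemma abs_map_le (L : C(Set.Icc a b, ℝ) →ₚ[ℝ] ℝ) {f g : C(Set.Icc a b, ℝ)}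
    (h : ∀ x, |f x| ≤ g x) : |L f| ≤ L g := by
  rw [abs_le, ← map_neg]
  exact ⟨OrderHomClass.mono L fun x => neg_le_of_abs_le (h x),
    OrderHomClass.mono L fun x => le_of_abs_le (h x)⟩

/-- A positive linear functional on `C([a, b])` as a continuous linear functional. -/
def toCLM (L : C(Set.Icc a b, ℝ) →ₚ[ℝ] ℝ) : C(Set.Icc a b, ℝ) →L[ℝ] ℝ :=
  LinearMap.mkContinuous L.toLinearMap (L 1) fun f => by
    have h := abs_map_le L (f := f) (g := ‖f‖ • (1 : C(Set.Icc a b, ℝ)))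
      fun x => by simpa using f.norm_coe_le_norm x
    rw [map_smul, smul_eq_mul, mul_comm] at h
    exact h

@[simp] lemma toCLM_apply (L : C(Set.Icc a b, ℝ) →ₚ[ℝ] ℝ) (f : C(Set.Icc a b, ℝ)) :
    toCLM L f = L f := rfl

/-- The integration error `L - Q_X(w)`. -/
def errorFunctional (L : C(Set.Icc a b, ℝ) →ₚ[ℝ] ℝ) (X : Fin N → Set.Icc a b) (w : Fin N → ℝ) :
    C(Set.Icc a b, ℝ) →L[ℝ] ℝ :=
  toCLM L - ∑ n, w n • ContinuousMap.evalCLM ℝ (X n)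

lemma errorFunctional_apply (L : C(Set.Icc a b, ℝ) →ₚ[ℝ] ℝ) (X : Fin N → Set.Icc a b)
    (w : Fin N → ℝ) (f : C(Set.Icc a b, ℝ)) :
    errorFunctional L X w f = L f - quadrature X w f := by
  simp [errorFunctional, quadrature]

/-- The function `y ↦ K_ℓ(x, y)`. -/
def kernelSection (ℓ : ℝ) (x : Set.Icc a b) : C(Set.Icc a b, ℝ) :=
  ⟨fun y => Real.exp (-((x : ℝ) - y) ^ 2 / (2 * ℓ ^ 2)), by fun_prop⟩

lemma kerFun_toContinuousMap (ℓ : ℝ) (x : Set.Icc a b) :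
    (RKHS.kerFun (GaussianRKHS a b ℓ) x (1 : ℝ)).toContinuousMap = kernelSection ℓ x := by
  ext y
  change RKHS.kerFun (GaussianRKHS a b ℓ) x (1 : ℝ) y = _
  rw [RKHS.kerFun_apply, RKHS.OfKernel.kernel_ofKernel, gaussianKernel_apply, mul_one,
    ← neg_sq, neg_sub]
  rfl

lemma norm_toContinuousMap_le {ℓ : ℝ} (f : GaussianRKHS a b ℓ) : ‖f.toContinuousMap‖ ≤ ‖f‖ := by
  rw [ContinuousMap.norm_le _ (norm_nonneg f)]
  intro x
  have h := RKHS.norm_apply_le (𝕜 := ℝ) f x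
  rw [RKHS.OfKernel.kernel_ofKernel] at h
  have h1 : ‖gaussianKernel a b ℓ x x‖ = 1 := by
    simp [gaussianKernel]
  rw [h1, Real.sqrt_one, mul_one] at h
  exact h

lemma exists_representer (D : C(Set.Icc a b, ℝ) →L[ℝ] ℝ) (ℓ : ℝ) :
    ∃ z : GaussianRKHS a b ℓ, (∀ f : GaussianRKHS a b ℓ, D f.toContinuousMap = inner ℝ z f) ∧
      ∀ x, z.toContinuousMap x = D (kernelSection ℓ x) := by
  let T : GaussianRKHS a b ℓ →L[ℝ] C(Set.Icc a b, ℝ) :=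
    LinearMap.mkContinuous
      { toFun := fun f => f.toContinuousMap
        map_add' := fun f g => by
          ext x; exact congrFun (RKHS.coe_add (𝕜 := ℝ) f g) x
        map_smul' := fun c f => by
          ext x; exact congrFun (RKHS.coe_smul (𝕜 := ℝ) f c) x } 1
      fun f => by rw [one_mul]; exact norm_toContinuousMap_le f
  have hz : ∀ f : GaussianRKHS a b ℓ, D f.toContinuousMap
      = inner ℝ ((InnerProductSpace.toDual ℝ (GaussianRKHS a b ℓ)).symm (D ∘L T)) f := by
    intro f
    rw [InnerProductSpace.toDual_symm_apply]
    rfl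
  refine ⟨_, hz, fun x => ?_⟩
  rw [← kerFun_toContinuousMap, hz, RKHS.inner_kerFun]
  simp [GaussianRKHS.toContinuousMap]

lemma worstCaseError_nonneg (L : C(Set.Icc a b, ℝ) →ₚ[ℝ] ℝ) (ℓ : ℝ) (X : Fin N → Set.Icc a b)
    (w : Fin N → ℝ) : 0 ≤ worstCaseError L ℓ X w :=
  Real.iSup_nonneg fun _ => abs_nonneg _

lemma worstCaseError_eq_norm {L : C(Set.Icc a b, ℝ) →ₚ[ℝ] ℝ} {ℓ : ℝ} {X : Fin N → Set.Icc a b}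
    {w : Fin N → ℝ} {z : GaussianRKHS a b ℓ}
    (hz : ∀ f : GaussianRKHS a b ℓ, errorFunctional L X w f.toContinuousMap = inner ℝ z f) :
    worstCaseError L ℓ X w = ‖z‖ := by
  simp only [worstCaseError, ← errorFunctional_apply, hz]
  have hle : ∀ f : {f : GaussianRKHS a b ℓ // ‖f‖ ≤ 1}, |inner ℝ z f.1| ≤ ‖z‖ := fun f =>
    (abs_real_inner_le_norm _ _).trans (mul_le_of_le_one_right (norm_nonneg z) f.2)
  have : Nonempty {f : GaussianRKHS a b ℓ // ‖f‖ ≤ 1} := ⟨⟨0, by simp⟩⟩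
  refine le_antisymm (ciSup_le hle) ?_
  by_cases h0 : ‖z‖ = 0
  · rw [h0]; exact Real.iSup_nonneg fun _ => abs_nonneg _
  refine le_ciSup_of_le ⟨‖z‖, by rintro _ ⟨f, rfl⟩; exact hle f⟩
    ⟨‖z‖⁻¹ • z, by rw [norm_smul, norm_inv, norm_norm, inv_mul_cancel₀ h0]⟩ ?_
  simp only
  rw [real_inner_smul_right, real_inner_self_eq_norm_sq, pow_two, inv_mul_cancel_left₀ h0]
  exact le_abs_self _

/-- The squared worst-case error is the error functional applied to both arguments of the kernel. -/
lemma exists_worstCaseError_sq (L : C(Set.Icc a b, ℝ) →ₚ[ℝ] ℝ) (ℓ : ℝ) (X : Fin N → Set.Icc a b)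
    (w : Fin N → ℝ) : ∃ g : C(Set.Icc a b, ℝ),
      (∀ x, g x = errorFunctional L X w (kernelSection ℓ x)) ∧
      worstCaseError L ℓ X w ^ 2 = errorFunctional L X w g := by
  obtain ⟨z, hz, hzx⟩ := exists_representer (errorFunctional L X w) ℓ
  exact ⟨z.toContinuousMap, hzx, by
    rw [worstCaseError_eq_norm hz, hz, real_inner_self_eq_norm_sq]⟩

/-- The features `φₙ(x) = exp(-x²/(2ℓ²)) xⁿ / (ℓⁿ √n!)` of the Gaussian kernel. -/
def feature (a b ℓ : ℝ) (n : ℕ) : C(Set.Icc a b, ℝ) :=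
  ⟨fun x => Real.exp (-(x : ℝ) ^ 2 / (2 * ℓ ^ 2)) * (x : ℝ) ^ n / (ℓ ^ n * √n.factorial),
    by fun_prop⟩

lemma feature_apply (ℓ : ℝ) (n : ℕ) (x : Set.Icc a b) : feature a b ℓ n x =
    Real.exp (-(x : ℝ) ^ 2 / (2 * ℓ ^ 2)) * (x : ℝ) ^ n / (ℓ ^ n * √n.factorial) := rfl

lemma hasSum_feature (ℓ : ℝ) (x y : Set.Icc a b) :
    HasSum (fun n => feature a b ℓ n x * feature a b ℓ n y) (kernelSection ℓ x y) := by
  have h := (NormedSpace.expSeries_div_hasSum_exp ((x : ℝ) * y / ℓ ^ 2)).mul_left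
    (Real.exp (-(x : ℝ) ^ 2 / (2 * ℓ ^ 2)) * Real.exp (-(y : ℝ) ^ 2 / (2 * ℓ ^ 2)))
  rw [← Real.exp_eq_exp_ℝ, ← Real.exp_add, ← Real.exp_add] at h
  have e : kernelSection ℓ x y = Real.exp (-(x : ℝ) ^ 2 / (2 * ℓ ^ 2) + -(y : ℝ) ^ 2 / (2 * ℓ ^ 2) +
      (x : ℝ) * y / ℓ ^ 2) := by
    simp only [kernelSection, ContinuousMap.coe_mk]
    congr 1
    -- With division by zero equal to 0, all exponents vanish at ℓ = 0.
    by_cases h0 : ℓ = 0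
    · simp [h0]
    field_simp
    ring
  rw [e]
  refine h.congr_fun fun n => ?_
  have hs : √(n.factorial : ℝ) * √n.factorial = n.factorial := Real.mul_self_sqrt (by positivity)
  rw [feature_apply, feature_apply, div_mul_div_comm,
    show ℓ ^ n * √(n.factorial : ℝ) * (ℓ ^ n * √n.factorial)
      = (ℓ ^ n) ^ 2 * (√(n.factorial : ℝ) * √n.factorial) by ring, hs, Real.exp_add, div_pow,
    mul_pow, div_div, mul_div_assoc', ← pow_mul, ← pow_mul, mul_comm n 2]
  ring

/-- Gives sup-norm convergence of the expansions, so that D may be applied termwise. -/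
lemma summable_norm_feature_sq (a b ℓ : ℝ) : Summable fun n => ‖feature a b ℓ n‖ ^ 2 := by
  set M := max |a| |b|
  have hM : 0 ≤ M := le_max_of_le_left (abs_nonneg a)
  refine Summable.of_nonneg_of_le (fun n => sq_nonneg _) (fun n => ?_)
    (Real.summable_pow_div_factorial (M ^ 2 / ℓ ^ 2))
  have h : ‖feature a b ℓ n‖ ≤ M ^ n / (|ℓ| ^ n * √n.factorial) := by
    rw [ContinuousMap.norm_le _ (by positivity)]
    intro x
    rw [feature_apply, Real.norm_eq_abs, abs_div, abs_mul, abs_mul, abs_pow, abs_pow,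
      abs_of_nonneg (Real.sqrt_nonneg _), abs_of_pos (Real.exp_pos _)]
    have h1 : Real.exp (-(x : ℝ) ^ 2 / (2 * ℓ ^ 2)) ≤ 1 :=
      Real.exp_le_one_iff.mpr (div_nonpos_of_nonpos_of_nonneg
        (neg_nonpos.mpr (sq_nonneg _)) (by positivity))
    have h2 : |(x : ℝ)| ≤ M := abs_le_max_abs_abs x.2.1 x.2.2
    gcongr
    calc _ ≤ 1 * M ^ n := by gcongr
      _ = M ^ n := one_mul _
  calc ‖feature a b ℓ n‖ ^ 2 ≤ (M ^ n / (|ℓ| ^ n * √n.factorial)) ^ 2 := by gcongr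
    _ = _ := by
      rw [div_pow, mul_pow, Real.sq_sqrt (by positivity), ← pow_mul, ← pow_mul, mul_comm n 2,
        pow_mul, pow_mul, sq_abs, div_pow, div_div]

/-- Applying D in one variable and then the other yields e_ℓ² = ∑ (D φₙ)², which dominates each
term. -/
lemma abs_errorFunctional_feature_le (L : C(Set.Icc a b, ℝ) →ₚ[ℝ] ℝ) (ℓ : ℝ)
    (X : Fin N → Set.Icc a b) (w : Fin N → ℝ) (n : ℕ) :
    |errorFunctional L X w (feature a b ℓ n)| ≤ worstCaseError L ℓ X w := by
  obtain ⟨g, hg, he⟩ := exists_worstCaseError_sq L ℓ X w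
  set D := errorFunctional L X w
  have hsec : ∀ x, HasSum (fun n => feature a b ℓ n x * D (feature a b ℓ n)) (g x) := by
    intro x
    have hs : Summable fun n => feature a b ℓ n x • feature a b ℓ n := by
      refine Summable.of_norm_bounded (summable_norm_feature_sq a b ℓ) fun n => ?_
      rw [norm_smul, pow_two]
      gcongr
      exact ContinuousMap.norm_coe_le_norm _ _
    have hk : ∑' n, feature a b ℓ n x • feature a b ℓ n = kernelSection ℓ x := by
      ext y
      have h := (ContinuousMap.evalCLM ℝ y).hasSum hs.hasSum
      exact h.unique (hasSum_feature ℓ x y)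
    have h := D.hasSum hs.hasSum
    rw [hk, ← hg] at h
    simpa using h
  have hs : Summable fun n => D (feature a b ℓ n) • feature a b ℓ n := by
    refine Summable.of_norm_bounded ((summable_norm_feature_sq a b ℓ).mul_left ‖D‖) fun n => ?_
    rw [norm_smul, pow_two, ← mul_assoc]
    gcongr
    exact D.le_opNorm _
  have hk : ∑' n, D (feature a b ℓ n) • feature a b ℓ n = g := by
    ext x
    have h := (ContinuousMap.evalCLM ℝ x).hasSum hs.hasSum
    refine h.unique ((hsec x).congr_fun fun n => ?_)
    simp [mul_comm]
  have h := D.hasSum hs.hasSum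
  rw [hk, ← he] at h
  refine abs_le_of_sq_le_sq ?_ (worstCaseError_nonneg L ℓ X w)
  have := le_hasSum h n fun m _ => by
    rw [map_smul, smul_eq_mul]; exact mul_self_nonneg _
  simpa [pow_two] using this

end ErrorFunctional

/-! ### Error of the Gaussian rule as ℓ → ∞ -/

section UpperBound

variable {a b : ℝ} {N : ℕ}

/-- The Taylor polynomial of order `m` in `ℓ⁻²` of `y ↦ K_ℓ(x, y)`. -/
def kernelTaylor (a b ℓ : ℝ) (m : ℕ) (x : ℝ) : C(Set.Icc a b, ℝ) :=
  ∑ n ∈ Finset.range m, ((-(2 * ℓ ^ 2)⁻¹) ^ n / (n.factorial : ℝ)) •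
    ∑ j ∈ Finset.range (2 * n + 1), ((-1) ^ (2 * n - j) * ((2 * n).choose j : ℝ) * x ^ j) •
      monomial a b (2 * n - j)

lemma kernelTaylor_apply (ℓ : ℝ) (m : ℕ) (x : ℝ) (y : Set.Icc a b) :
    kernelTaylor a b ℓ m x y
      = ∑ n ∈ Finset.range m, (-(x - y) ^ 2 / (2 * ℓ ^ 2)) ^ n / n.factorial := by
  simp only [kernelTaylor, ContinuousMap.coe_sum, Finset.sum_apply, ContinuousMap.coe_smul,
    Pi.smul_apply, smul_eq_mul]
  refine Finset.sum_congr rfl fun n _ => ?_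
  have h : ∑ j ∈ Finset.range (2 * n + 1), (-1) ^ (2 * n - j) * ((2 * n).choose j : ℝ) * x ^ j *
      monomial a b (2 * n - j) y = (x - y) ^ (2 * n) := by
    rw [sub_eq_add_neg, add_pow]
    refine Finset.sum_congr rfl fun j _ => ?_
    rw [neg_pow (y : ℝ)]
    simp only [monomial, ContinuousMap.coe_mk]
    ring
  rw [h, pow_mul, div_eq_mul_inv (-(x - (y : ℝ)) ^ 2), neg_mul, ← mul_neg, mul_pow]
  ring

/-- The condition b - a ≤ ℓ puts the exponent in [-1, 1], where `Real.exp_bound` applies. -/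
lemma abs_kernelSection_sub_taylor_le {ℓ : ℝ} (hℓ : 0 < ℓ) (hab : b - a ≤ ℓ) {m : ℕ} (hm : 0 < m)
    (x y : Set.Icc a b) :
    |kernelSection ℓ x y - kernelTaylor a b ℓ m x y| ≤
      ((b - a) ^ (2 * m) * (m.succ / (m.factorial * m))) * (ℓ ^ (2 * m))⁻¹ := by
  rw [kernelTaylor_apply]
  set t := -((x : ℝ) - y) ^ 2 / (2 * ℓ ^ 2) with ht
  have hxy : |(x : ℝ) - y| ≤ b - a := by
    rw [abs_le]; constructor <;> linarith [x.2.1, x.2.2, y.2.1, y.2.2]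
  have h0 : 0 ≤ b - a := (abs_nonneg _).trans hxy
  have ht' : |t| ≤ (b - a) ^ 2 / ℓ ^ 2 := by
    rw [ht, abs_div, abs_neg, abs_of_nonneg (sq_nonneg ((x : ℝ) - y)),
      abs_of_pos (by positivity : 0 < 2 * ℓ ^ 2), ← sq_abs]
    gcongr
    linarith [sq_nonneg ℓ]
  have h1 : (b - a) ^ 2 / ℓ ^ 2 ≤ 1 := by
    rw [div_le_one (by positivity)]
    gcongr
  refine (Real.exp_bound (ht'.trans h1) hm).trans ?_
  calc |t| ^ m * (m.succ / (m.factorial * m))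
      ≤ ((b - a) ^ 2 / ℓ ^ 2) ^ m * (m.succ / (m.factorial * m)) := by gcongr
    _ = _ := by rw [div_pow, ← pow_mul, ← pow_mul]; ring

lemma exists_worstCaseError_le (L : C(Set.Icc a b, ℝ) →ₚ[ℝ] ℝ) (hN : 0 < N)
    {X : Fin N → Set.Icc a b} {w : Fin N → ℝ} (hG : IsGaussianRule L X w) :
    ∃ C : ℝ, ∀ ℓ : ℝ, 0 < ℓ → b - a ≤ ℓ → worstCaseError L ℓ X w ≤ C * (ℓ ^ (2 * N))⁻¹ := by
  set D := errorFunctional L X w with hD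
  have hmom : ∀ n < 2 * N, D (monomial a b n) = 0 := fun n hn => by
    rw [hD, errorFunctional_apply, hG.2 n hn, sub_self]
  set m := 2 * N
  set A := (b - a) ^ (2 * m) * (m.succ / (m.factorial * m) : ℝ)
  refine ⟨‖D‖ * √A, fun ℓ hℓ hℓab => ?_⟩
  obtain ⟨g, hg, he⟩ := exists_worstCaseError_sq L ℓ X w
  rw [← hD] at he
  have hA : 0 ≤ A := by
    have : Even (2 * m) := even_two_mul m
    exact mul_nonneg (this.pow_nonneg _) (by positivity)
  -- P is D applied to the Taylor polynomial in its second variable.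
  let P : C(Set.Icc a b, ℝ) :=
    ∑ n ∈ Finset.range m, ((-(2 * ℓ ^ 2)⁻¹) ^ n / (n.factorial : ℝ)) •
      ∑ j ∈ Finset.range (2 * n + 1), ((-1) ^ (2 * n - j) * ((2 * n).choose j : ℝ) *
        D (monomial a b (2 * n - j))) • monomial a b j
  have hP : ∀ x, P x = D (kernelTaylor a b ℓ m x) := by
    intro x
    simp only [P, kernelTaylor, map_sum, map_smul, ContinuousMap.coe_sum, Finset.sum_apply,
      ContinuousMap.coe_smul, Pi.smul_apply, smul_eq_mul]
    refine Finset.sum_congr rfl fun n _ => ?_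
    congr 1
    refine Finset.sum_congr rfl fun j _ => ?_
    simp only [monomial, ContinuousMap.coe_mk]
    ring
  have hDP : D P = 0 := by
    simp only [P, map_sum, map_smul, smul_eq_mul]
    refine Finset.sum_eq_zero fun n hn => mul_eq_zero_of_right _ (Finset.sum_eq_zero fun j _ => ?_)
    rw [Finset.mem_range] at hn
    -- The degrees j and 2n - j add up to less than 4N, so one of them is below 2N.
    by_cases hj : j < m
    · rw [hmom j hj, mul_zero]
    · rw [hmom (2 * n - j) (by omega)]; ring
  have hsub : ‖g - P‖ ≤ ‖D‖ * (A * (ℓ ^ (2 * m))⁻¹) := by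
    rw [ContinuousMap.norm_le _ (by positivity)]
    intro x
    rw [ContinuousMap.sub_apply, hg, hP, ← map_sub]
    refine (D.le_opNorm _).trans ?_
    gcongr
    rw [ContinuousMap.norm_le _ (by positivity)]
    intro y
    exact abs_kernelSection_sub_taylor_le hℓ hℓab (by omega) x y
  refine le_of_abs_le (abs_le_of_sq_le_sq ?_ (by positivity))
  calc worstCaseError L ℓ X w ^ 2 = D (g - P) := by rw [he, map_sub, hDP, sub_zero]
    _ ≤ ‖D‖ * ‖g - P‖ := (le_abs_self _).trans (D.le_opNorm _)
    _ ≤ ‖D‖ * (‖D‖ * (A * (ℓ ^ (2 * m))⁻¹)) := by gcongr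
    _ = _ := by
      rw [mul_pow, mul_pow, Real.sq_sqrt hA, inv_pow, ← pow_mul, mul_comm m 2]
      ring

end UpperBound

/-! ### Nondegeneracy of L from uniqueness of the optimal rule -/

section Nondegenerate

open Polynomial

variable {a b : ℝ} {N : ℕ}

/-- The polynomial moment functional of `L`. -/
def polyFunctional (L : C(Set.Icc a b, ℝ) →ₚ[ℝ] ℝ) : ℝ[X] →ₗ[ℝ] ℝ :=
  L.toLinearMap ∘ₗ (toContinuousMapOnAlgHom (Set.Icc a b)).toLinearMap

lemma polyFunctional_apply (L : C(Set.Icc a b, ℝ) →ₚ[ℝ] ℝ) (p : ℝ[X]) :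
    polyFunctional L p = L (p.toContinuousMapOn (Set.Icc a b)) := rfl

lemma polyFunctional_X_pow (L : C(Set.Icc a b, ℝ) →ₚ[ℝ] ℝ) (n : ℕ) :
    polyFunctional L (X ^ n) = L (FlatLimit.monomial a b n) := by
  rw [polyFunctional_apply]
  congr 1
  ext x
  simp [FlatLimit.monomial]

lemma polyFunctional_nonneg (L : C(Set.Icc a b, ℝ) →ₚ[ℝ] ℝ) {p : ℝ[X]}
    (h : ∀ x ∈ Set.Icc a b, 0 ≤ p.eval x) : 0 ≤ polyFunctional L p :=
  L.map_nonneg fun x => h x x.2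

/-- If `L[p²] = 0`, then `L` vanishes on functions that vanish on the zeros of `p`. -/
lemma map_eq_zero_of_map_sq_eq_zero (L : C(Set.Icc a b, ℝ) →ₚ[ℝ] ℝ) {p f : C(Set.Icc a b, ℝ)}
    (hp : L (p ^ 2) = 0) (hf : ∀ x, p x = 0 → f x = 0) : L f = 0 := by
  have key : ∀ ε > 0, |L f| ≤ ε * L 1 := by
    intro ε hε
    have hK : IsCompact {x | ε ≤ |f x|} :=
      (isClosed_le continuous_const (by fun_prop)).isCompact
    -- On the compact set |f| ≥ ε, p has no zero, so p² is bounded below by a positive constant.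
    have hC : ∃ C : ℝ, ∀ x, |f x| ≤ ε + C * p x ^ 2 := by
      rcases Set.eq_empty_or_nonempty {x | ε ≤ |f x|} with h | h
      · refine ⟨0, fun x => ?_⟩
        have : x ∉ {x | ε ≤ |f x|} := by simp [h]
        simpa using (not_le.mp this).le
      obtain ⟨z, hz, hmin⟩ := hK.exists_isMinOn h (f := fun x => p x ^ 2) (by fun_prop)
      have hpz : p z ≠ 0 := fun h0 => by
        have hz' : ε ≤ |f z| := hz
        rw [hf z h0, abs_zero] at hz'
        exact hz'.not_gt hε
      have hz0 : 0 < p z ^ 2 := by positivity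
      refine ⟨‖f‖ / p z ^ 2, fun x => ?_⟩
      by_cases hx : ε ≤ |f x|
      · have h1 : p z ^ 2 ≤ p x ^ 2 := hmin hx
        have h2 : |f x| ≤ ‖f‖ := f.norm_coe_le_norm x
        have h3 : ‖f‖ ≤ ‖f‖ / p z ^ 2 * p x ^ 2 := by
          rw [div_mul_eq_mul_div, le_div_iff₀ hz0]
          gcongr
        linarith
      · have : 0 ≤ ‖f‖ / p z ^ 2 * p x ^ 2 := by positivity
        linarith
    obtain ⟨C, hC⟩ := hC
    have h := abs_map_le L (f := f) (g := ε • (1 : C(Set.Icc a b, ℝ)) + C • p ^ 2)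
      fun x => by simpa using hC x
    rw [map_add, map_smul, map_smul, hp, smul_zero, add_zero, smul_eq_mul] at h
    exact h
  have h1 : 0 ≤ L 1 := L.map_nonneg fun _ => zero_le_one
  by_contra hne
  have hpos : 0 < |L f| := abs_pos.mpr hne
  have := key (|L f| / (2 * (L 1 + 1))) (by positivity)
  rw [div_mul_eq_mul_div, le_div_iff₀ (by positivity)] at this
  nlinarith

/-- If `L[p²] = 0`, then `L` is a quadrature rule on any nodes that contain the zeros of `p`. -/
lemma exists_worstCaseError_eq_zero (L : C(Set.Icc a b, ℝ) →ₚ[ℝ] ℝ) {p : C(Set.Icc a b, ℝ)}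
    (hp : L (p ^ 2) = 0) {Y : Fin N → Set.Icc a b} (hY : Function.Injective Y)
    (hz : ∀ x, p x = 0 → x ∈ Set.range Y) :
    ∃ v : Fin N → ℝ, ∀ ℓ, worstCaseError L ℓ Y v = 0 := by
  let y : Fin N → ℝ := fun i => Y i
  have hy : Set.InjOn y (Finset.univ : Finset (Fin N)) :=
    (Subtype.val_injective.comp hY).injOn
  refine ⟨fun i => polyFunctional L (Lagrange.basis Finset.univ y i), fun ℓ => ?_⟩
  have h : ∀ f : C(Set.Icc a b, ℝ), L f
      = quadrature Y (fun i => polyFunctional L (Lagrange.basis Finset.univ y i)) f := by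
    intro f
    set q := Lagrange.interpolate Finset.univ y (fun i => f (Y i)) with hq
    have h0 := map_eq_zero_of_map_sq_eq_zero L hp
      (f := f - q.toContinuousMapOn (Set.Icc a b)) fun x hx => by
        obtain ⟨i, rfl⟩ := hz x hx
        have := Lagrange.eval_interpolate_at_node (fun i => f (Y i)) hy (Finset.mem_univ i)
        simpa [sub_eq_zero, hq, y] using this.symm
    rw [map_sub, sub_eq_zero] at h0
    rw [h0, ← polyFunctional_apply, hq, Lagrange.interpolate_apply, map_sum]
    refine Finset.sum_congr rfl fun i _ => ?_
    rw [← smul_eq_C_mul, map_smul, smul_eq_mul, mul_comm]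
  simp [worstCaseError, h]

lemma polyFunctional_sq_pos (hab : a < b) (hN : 0 < N) (L : C(Set.Icc a b, ℝ) →ₚ[ℝ] ℝ)
    {ℓ : ℝ} {X : Fin N → Set.Icc a b}
    (huniq : ∀ (Y : Fin N → Set.Icc a b) (v : Fin N → ℝ), IsOptimalRule L ℓ Y v → Y = X)
    {p : ℝ[X]} (hp : p ≠ 0) (hpN : p.degree < N) : 0 < polyFunctional L (p ^ 2) := by
  refine lt_of_le_of_ne (polyFunctional_nonneg L fun x _ => by
    rw [eval_pow]; exact sq_nonneg _) fun h0 => ?_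
  have hinf : Infinite (Set.Icc a b) := (Set.Icc_infinite hab).to_subtype
  let pc := p.toContinuousMapOn (Set.Icc a b)
  have hpc : L (pc ^ 2) = 0 := by
    rw [h0, polyFunctional_apply]
    congr 1
    ext x
    simp [pc]
  classical
  have hzero : ({x : Set.Icc a b | pc x = 0}).Finite := by
    refine Set.Finite.of_finite_image (f := Subtype.val) ?_ Subtype.val_injective.injOn
    refine (p.roots.toFinset.finite_toSet).subset ?_
    rintro _ ⟨x, hx, rfl⟩
    simpa [hp] using (show eval (x : ℝ) p = 0 from hx)
  have hcard : hzero.toFinset.card ≤ N - 1 := by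
    have h1 : (hzero.toFinset.image Subtype.val).card ≤ p.roots.toFinset.card := by
      refine Finset.card_le_card fun c hc => ?_
      obtain ⟨x, hx, rfl⟩ := Finset.mem_image.mp hc
      simpa [hp] using (show eval (x : ℝ) p = 0 from hzero.mem_toFinset.mp hx)
    rw [Finset.card_image_of_injective _ Subtype.val_injective] at h1
    have h2 := p.roots.toFinset_card_le
    have h3 := p.card_roots'
    have h4 := (natDegree_lt_iff_degree_lt hp).mpr hpN
    omega
  -- Pad the zeros of p to N - 1 points. Any further node u gives a zero-error, hence optimal, rule,
  -- and two choices of u contradict uniqueness.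
  obtain ⟨S, hS, hSc⟩ := Infinite.exists_superset_card_eq _ _ hcard
  have key : ∀ u ∉ S, Set.range X = insert u (S : Set (Set.Icc a b)) := by
    intro u hu
    have hc : (insert u S).card = N := by rw [Finset.card_insert_of_notMem hu, hSc]; omega
    let Y := (insert u S).orderEmbOfFin hc
    have hr : Set.range Y = insert u (S : Set (Set.Icc a b)) := by
      rw [Finset.range_orderEmbOfFin, Finset.coe_insert]
    obtain ⟨v, hv⟩ := exists_worstCaseError_eq_zero L hpc Y.injective fun x hx => by
      rw [hr]
      exact Or.inr (hS (hzero.mem_toFinset.mpr hx))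
    rw [← huniq Y v ⟨Y.strictMono, fun Z c => (hv ℓ).trans_le (worstCaseError_nonneg L ℓ Z c)⟩, hr]
  obtain ⟨u, hu⟩ := Infinite.exists_notMem_finset S
  obtain ⟨u', hu'⟩ := Infinite.exists_notMem_finset (insert u S)
  rw [Finset.mem_insert, not_or] at hu'
  have : u' ∈ insert u (S : Set (Set.Icc a b)) := by
    rw [← key u hu, key u' hu'.2]; exact Set.mem_insert _ _
  rcases this with h | h
  · exact hu'.1 h
  · exact hu'.2 h

end Nondegenerate

/-! ### The flat limit -/

section FlatLimits

variable {a b : ℝ} {N : ℕ}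

/-- The Gaussian weight `x ↦ exp(-x²/(2ℓ²))`. -/
def gaussianWeight (a b ℓ : ℝ) : C(Set.Icc a b, ℝ) :=
  ⟨fun x => Real.exp (-(x : ℝ) ^ 2 / (2 * ℓ ^ 2)), by fun_prop⟩

lemma tendsto_const_div_two_mul_sq (M : ℝ) :
    Tendsto (fun ℓ : ℝ => M / (2 * ℓ ^ 2)) atTop (𝓝 0) :=
  Tendsto.const_div_atTop ((tendsto_pow_atTop two_ne_zero).const_mul_atTop two_pos) M

lemma tendsto_gaussianWeight (a b : ℝ) : Tendsto (gaussianWeight a b) atTop (𝓝 1) := by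
  rw [tendsto_iff_norm_sub_tendsto_zero]
  refine squeeze_zero (fun _ => norm_nonneg _) (fun ℓ => ?_)
    (tendsto_const_div_two_mul_sq (max |a| |b| ^ 2))
  rw [ContinuousMap.norm_le _ (by positivity)]
  intro x
  have h1 : (x : ℝ) ^ 2 / (2 * ℓ ^ 2) ≤ max |a| |b| ^ 2 / (2 * ℓ ^ 2) := by
    rw [← sq_abs (x : ℝ)]
    gcongr
    exact abs_le_max_abs_abs x.2.1 x.2.2
  have h2 : 0 ≤ (x : ℝ) ^ 2 / (2 * ℓ ^ 2) := by positivity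
  have h3 := Real.add_one_le_exp (-((x : ℝ) ^ 2 / (2 * ℓ ^ 2)))
  have h4 := Real.exp_le_one_iff.mpr (neg_nonpos.mpr h2)
  simp only [gaussianWeight, ContinuousMap.sub_apply, ContinuousMap.coe_mk, ContinuousMap.one_apply,
    Real.norm_eq_abs, neg_div]
  rw [abs_le]
  constructor <;> linarith

lemma tendsto_weighted_moments (L : C(Set.Icc a b, ℝ) →ₚ[ℝ] ℝ)
    {X : ℝ → Fin N → Set.Icc a b} {w : ℝ → Fin N → ℝ}
    (hO : (fun ℓ => worstCaseError L ℓ (X ℓ) (w ℓ)) =O[atTop] fun ℓ : ℝ => (ℓ ^ (2 * N))⁻¹)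
    {n : ℕ} (hn : n < 2 * N) :
    Tendsto (fun ℓ => ∑ i, w ℓ i * gaussianWeight a b ℓ (X ℓ i) * (X ℓ i : ℝ) ^ n) atTop
      (𝓝 (L (monomial a b n))) := by
  have h1 : Tendsto (fun ℓ => L (gaussianWeight a b ℓ * monomial a b n)) atTop
      (𝓝 (L (monomial a b n))) := by
    have h := ((toCLM L).continuous.tendsto _).comp
      ((tendsto_gaussianWeight a b).mul_const (monomial a b n))
    rw [one_mul] at h
    exact h
  -- The factor ℓⁿ √n! undoes the normalisation of φₙ; the product is O(ℓ^(n-2N)).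
  have h2 : Tendsto (fun ℓ => ℓ ^ n * √n.factorial *
      errorFunctional L (X ℓ) (w ℓ) (feature a b ℓ n)) atTop (𝓝 0) := by
    have e1 : (fun ℓ => ℓ ^ n * √n.factorial *
        errorFunctional L (X ℓ) (w ℓ) (feature a b ℓ n)) =O[atTop]
        fun ℓ : ℝ => ℓ ^ n * (ℓ ^ (2 * N))⁻¹ := by
      have h : (fun ℓ => errorFunctional L (X ℓ) (w ℓ) (feature a b ℓ n)) =O[atTop]
          fun ℓ => worstCaseError L ℓ (X ℓ) (w ℓ) :=
        IsBigO.of_bound 1 (Eventually.of_forall fun ℓ => by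
          rw [one_mul]
          exact (abs_errorFunctional_feature_le L ℓ (X ℓ) (w ℓ) n).trans (le_abs_self _))
      have h' : (fun ℓ : ℝ => ℓ ^ n * √n.factorial) =O[atTop] fun ℓ => ℓ ^ n := by
        simpa only [mul_comm] using
          (isBigO_refl (fun ℓ : ℝ => ℓ ^ n) atTop).const_mul_left √n.factorial
      exact h'.mul (h.trans hO)
    refine e1.trans_tendsto ?_
    have h := tendsto_pow_div_pow_atTop_zero (𝕜 := ℝ) hn
    simpa only [div_eq_mul_inv] using h
  have h3 := h1.sub h2
  rw [sub_zero] at h3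
  refine h3.congr' ?_
  filter_upwards [eventually_gt_atTop 0] with ℓ hℓ
  have hs : ℓ ^ n * √(n.factorial : ℝ) ≠ 0 := by positivity
  have e : (ℓ ^ n * √(n.factorial : ℝ)) • feature a b ℓ n
      = gaussianWeight a b ℓ * monomial a b n := by
    ext x
    simp only [ContinuousMap.coe_smul, Pi.smul_apply, smul_eq_mul, feature_apply,
      ContinuousMap.mul_apply]
    rw [mul_div_cancel₀ _ hs]
    rfl
  rw [← smul_eq_mul (ℓ ^ n * √(n.factorial : ℝ)), ← map_smul, e, errorFunctional_apply,
    sub_sub_cancel, quadrature]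
  refine Finset.sum_congr rfl fun i _ => ?_
  simp only [ContinuousMap.mul_apply, monomial, ContinuousMap.coe_mk]
  ring

open Polynomial in
/-- Rules of optimal order in the flat limit converge to the Gaussian rule. -/
lemma tendsto_of_isBigO (L : C(Set.Icc a b, ℝ) →ₚ[ℝ] ℝ)
    (hpos : ∀ p : ℝ[X], p ≠ 0 → p.degree < N → 0 < polyFunctional L (p ^ 2))
    {xG wG : Fin N → ℝ} (hxG : StrictMono xG) (hG : ∀ p : ℝ[X], p.degree < (2 * N : ℕ) →
      ∑ i, wG i * p.eval (xG i) = polyFunctional L p)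
    {Y : ℝ → Fin N → Set.Icc a b} {w : ℝ → Fin N → ℝ} (hY : ∀ ℓ > 0, Monotone (Y ℓ))
    (hO : (fun ℓ => worstCaseError L ℓ (Y ℓ) (w ℓ)) =O[atTop] fun ℓ : ℝ => (ℓ ^ (2 * N))⁻¹) :
    Tendsto (fun ℓ i => (Y ℓ i : ℝ)) atTop (𝓝 xG) ∧ Tendsto w atTop (𝓝 wG) := by
  -- The Gaussian factor is absorbed into the weights and divided out afterwards, since it tends to
  -- 1.
  have h := tendsto_of_tendsto_moments hpos hxG hG (l := atTop) (x := fun ℓ i => (Y ℓ i : ℝ))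
    (v := fun ℓ i => w ℓ i * gaussianWeight a b ℓ (Y ℓ i))
    ((eventually_gt_atTop 0).mono fun ℓ hℓ _ _ hij => hY ℓ hℓ hij) (fun ℓ i => (Y ℓ i).2)
    fun n hn => by
      rw [polyFunctional_X_pow]
      exact tendsto_weighted_moments L hO hn
  refine ⟨h.1, tendsto_pi_nhds.mpr fun i => ?_⟩
  have hg : Tendsto (fun ℓ => gaussianWeight a b ℓ (Y ℓ i)) atTop (𝓝 1) := by
    rw [tendsto_iff_norm_sub_tendsto_zero]
    exact squeeze_zero (fun _ => norm_nonneg _)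
      (fun ℓ => ContinuousMap.norm_coe_le_norm (gaussianWeight a b ℓ - 1) (Y ℓ i))
      (tendsto_iff_norm_sub_tendsto_zero.mp (tendsto_gaussianWeight a b))
  have hd := (tendsto_pi_nhds.mp h.2 i).div hg one_ne_zero
  rw [div_one] at hd
  exact hd.congr fun ℓ => mul_div_cancel_right₀ _ (Real.exp_ne_zero _)

end FlatLimits

end FlatLimit

end

/-! ### The main theorem -/

theorem theorem4 {a b : ℝ} (hab : a < b) (N : ℕ) (hN : 0 < N)
    (L : C(Set.Icc a b, ℝ) →ₚ[ℝ] ℝ)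
    (X : ℝ → Fin N → Set.Icc a b) (w : ℝ → Fin N → ℝ)
    (hopt : ∀ ℓ > 0, FlatLimit.IsOptimalRule L ℓ (X ℓ) (w ℓ))
    (huniq : ∀ ℓ > 0, ∀ (Y : Fin N → Set.Icc a b) (v : Fin N → ℝ),
      FlatLimit.IsOptimalRule L ℓ Y v → Y = X ℓ ∧ v = w ℓ) :
    (∃ (XG : Fin N → Set.Icc a b) (wG : Fin N → ℝ),
      FlatLimit.IsGaussianRule L XG wG ∧
      (∀ (Y : Fin N → Set.Icc a b) (v : Fin N → ℝ),
        FlatLimit.IsGaussianRule L Y v → Y = XG ∧ v = wG) ∧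
      Tendsto X atTop (𝓝 XG) ∧ Tendsto w atTop (𝓝 wG)) ∧
    (fun ℓ : ℝ => FlatLimit.worstCaseError L ℓ (X ℓ) (w ℓ)) =O[atTop]
      (fun ℓ : ℝ => (ℓ ^ (2 * N))⁻¹) := by
  have hpos : ∀ p : Polynomial ℝ, p ≠ 0 → p.degree < N → 0 < FlatLimit.polyFunctional L (p ^ 2) := fun p hp hpN =>
    FlatLimit.polyFunctional_sq_pos hab hN L (fun Y v h => (huniq 1 one_pos Y v h).1) hp hpN
  obtain ⟨x, wG, hx, hxab, hG⟩ := FlatLimit.exists_gauss hpos (a := a) (b := b)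
    (fun p => FlatLimit.polyFunctional_nonneg L fun x hx => by
      simpa using mul_nonneg (sub_nonneg.mpr hx.1) (sq_nonneg (p.eval x)))
    (fun p => FlatLimit.polyFunctional_nonneg L fun x hx => by
      simpa using mul_nonneg (sub_nonneg.mpr hx.2) (sq_nonneg (p.eval x)))
  let XG : Fin N → Set.Icc a b := fun i => ⟨x i, hxab i⟩
  have hGauss : FlatLimit.IsGaussianRule L XG wG := by
    refine ⟨fun i j hij => hx hij, fun n hn => ?_⟩
    rw [← FlatLimit.polyFunctional_X_pow, ← hG (Polynomial.X ^ n) (by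
      rw [Polynomial.degree_X_pow]; exact_mod_cast hn)]
    simp [FlatLimit.quadrature, FlatLimit.monomial, XG]
  obtain ⟨C, hC⟩ := FlatLimit.exists_worstCaseError_le L hN hGauss
  have hO : (fun ℓ : ℝ => FlatLimit.worstCaseError L ℓ (X ℓ) (w ℓ)) =O[atTop]
      (fun ℓ : ℝ => (ℓ ^ (2 * N))⁻¹) := by
    refine IsBigO.of_bound C ?_
    filter_upwards [eventually_gt_atTop 0, eventually_ge_atTop (b - a)] with ℓ h0 h1
    rw [Real.norm_of_nonneg (FlatLimit.worstCaseError_nonneg L ℓ _ _), Real.norm_of_nonneg (by positivity)]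
    exact ((hopt ℓ h0).2 XG wG).trans (hC ℓ h0 h1)
  obtain ⟨hX, hw⟩ := FlatLimit.tendsto_of_isBigO L hpos hx hG (fun ℓ hℓ => (hopt ℓ hℓ).1.monotone) hO
  refine ⟨⟨XG, wG, hGauss, fun Y v hY => ?_, ?_, hw⟩, hO⟩
  -- Uniqueness: a second Gaussian rule, as a constant family, converges to the first.
  · have h := FlatLimit.tendsto_of_tendsto_moments hpos hx hG (l := (atTop : Filter ℕ))
      (x := fun _ i => (Y i : ℝ)) (v := fun _ => v)
      (Eventually.of_forall fun _ _ _ hij => hY.1.monotone hij) (fun _ i => (Y i).2)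
      fun n hn => by
        rw [FlatLimit.polyFunctional_X_pow, ← hY.2 n hn]
        exact tendsto_const_nhds
    rw [tendsto_const_nhds_iff, tendsto_const_nhds_iff] at h
    exact ⟨funext fun i => Subtype.ext (congrFun h.1 i), h.2⟩
  · exact tendsto_pi_nhds.mpr fun i => tendsto_subtype_rng.mpr (tendsto_pi_nhds.mp hX i)
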